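/- Conventions. A Banach sequence space is a complex Banach space $E\subseteq\mathbb C^{\mathbb N}$ with $\ell_1\subseteq E\subseteq\ell_\infty$ such that $x\in\mathbb C^{\mathbb N}$, $y\in E$ and $|x(k)|\le|y(k)|$ for all $k$ imply $x\in E$ and $\|x\|_E\le\|y\|_E$. It is symmetric if, for every $x\in E$, the decreasing rearrangement $x^\star(k)=\inf\{\sup_{j\notin J}|x(j)| : J\subseteq\mathbb N,\ \mathrm{card}(J)<k\}$ belongs to $E$ and $\|x\|_E=\|x^\star\|_E$. Its Köthe dual is the Banach sequence space $E^\times=\{z\in\mathbb C^{\mathbb N}:\sum_k|z(k)x(k)|<\infty\text{ for all }x\in E\}$ with $\|z\|_{E^\times}=\sup_{\|x\|_E\le1}\sum_k|z(k)x(k)|$, and $E^{\times\times}=(E^\times)^\times$. An ideal $\mathfrak A$ of $n$-linear forms assigns to all complex Banach spaces $E_1,\dots,E_n$ a set $\mathfrak A(E_1,\dots,E_n)$ of continuous $n$-linear forms on $E_1\times\cdots\times E_n$ that contains all forms $(x_1,\dots,x_n)\mapsto\gamma_1(x_1)\cdots\gamma_n(x_n)$ with $\gamma_i\in E_i^*$,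 is closed under addition, and satisfies $T\circ(S_1,\dots,S_n)\in\mathfrak A(F_1,\dots,F_n)$ whenever $T\in\mathfrak A(E_1,\dots,E_n)$ and $S_i:F_i\to E_i$ are bounded linear operators. It is a Banach ideal if each $\mathfrak A(E_1,\dots,E_n)$ carries a complete norm $\|\cdot\|_{\mathfrak A}$ such that $\|(x_1,\dots,x_n)\mapsto\gamma_1(x_1)\cdots\gamma_n(x_n)\|_{\mathfrak A}=\|\gamma_1\|\cdots\|\gamma_n\|$ and $\|T\circ(S_1,\dots,S_n)\|_{\mathfrak A}\le\|T\|_{\mathfrak A}\|S_1\|\cdots\|S_n\|$. It is maximal if, for all $E_1,\dots,E_n$, a continuous $n$-linear form $T$ on $E_1\times\cdots\times E_n$ belongs to $\mathfrak A(E_1,\dots,E_n)$ exactly when $\sup\{\|T|_{M_1\times\cdots\times M_n}\|_{\mathfrak A(M_1,\dots,M_n)}: M_i\subseteq E_i,\ \dim M_i<\infty\}$ is finite, and $\|T\|_{\mathfrak A(E_1,\dots,E_n)}$ then equals this supremum. For a Banach sequence space $E$ let $\ell_n(\mathfrak A,E)$ be the set of all $\alpha\in\ell_\infty$ such that the diagonal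 form $T_\alpha(x_1,\dots,x_n)=\sum_{k=1}^\infty\alpha(k)x_1(k)\cdots x_n(k)$ is defined on $E\times\cdots\times E$ and belongs to $\mathfrak A(E,\dots,E)$, with $\|\alpha\|_{\ell_n(\mathfrak A,E)}=\|T_\alpha\|_{\mathfrak A(E,\dots,E)}$. **Proposition.** Let $n\ge1$, let $E$ be a symmetric Banach sequence space and let $\mathfrak A$ be a maximal Banach ideal of $n$-linear forms. Then $$\ell_n(\mathfrak A,E)=\ell_n(\mathfrak A,E^{\times\times})$$ as sets of sequences, and $\|\alpha\|_{\ell_n(\mathfrak A,E)}=\|\alpha\|_{\ell_n(\mathfrak A,E^{\times\times})}$ for every $\alpha$ in this space. -/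

import Mathlib

open Filter Topology

noncomputable section

/-! Banach sequence spaces -/

/-- A Banach sequence space: a complex Banach space `E` of complex sequences with
`ℓ₁ ⊆ E ⊆ ℓ_∞` such that `|x| ≤ |y|` coordinatewise and `y ∈ E` imply `x ∈ E` and `‖x‖ ≤ ‖y‖`.
The values of `nrm` outside `carrier` carry no information. -/
structure BanachSeqSpace where
  carrier : Submodule ℂ (ℕ → ℂ)
  nrm : (ℕ → ℂ) → ℝ
  nrm_nonneg : ∀ x ∈ carrier, 0 ≤ nrm x
  eq_zero_of_nrm : ∀ x ∈ carrier, nrm x = 0 → x = 0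
  nrm_add_le : ∀ x ∈ carrier, ∀ y ∈ carrier, nrm (x + y) ≤ nrm x + nrm y
  nrm_smul : ∀ (c : ℂ), ∀ x ∈ carrier, nrm (c • x) = ‖c‖ * nrm x
  complete : ∀ u : ℕ → ℕ → ℂ, (∀ m, u m ∈ carrier) →
    (∀ ε > 0, ∃ N, ∀ p ≥ N, ∀ q ≥ N, nrm (u p - u q) < ε) →
    ∃ x ∈ carrier, Tendsto (fun m => nrm (u m - x)) atTop (𝓝 0)
  l1_le : ∀ x : ℕ → ℂ, Summable (fun k => ‖x k‖) → x ∈ carrier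
  le_linf : ∀ x ∈ carrier, BddAbove (Set.range fun k => ‖x k‖)
  solid : ∀ x : ℕ → ℂ, ∀ y ∈ carrier, (∀ k, ‖x k‖ ≤ ‖y k‖) → x ∈ carrier ∧ nrm x ≤ nrm y

namespace BanachSeqSpace

/-- The Banach sequence space `E` as a type. (A type of its own, so that it carries the norm
topology of `E` and not the topology of coordinatewise convergence.) -/
def Elem (E : BanachSeqSpace) : Type := E.carrier

variable (E : BanachSeqSpace)

instance : AddCommGroup E.Elem := inferInstanceAs (AddCommGroup E.carrier)

instance : Module ℂ E.Elem := inferInstanceAs (Module ℂ E.carrier)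

/-- The sequence underlying an element of `E`. -/
def toSeq : E.Elem →ₗ[ℂ] (ℕ → ℂ) := E.carrier.subtype

instance : CoeFun E.Elem (fun _ => ℕ → ℂ) := ⟨fun x => E.toSeq x⟩

theorem toSeq_mem (x : E.Elem) : E.toSeq x ∈ E.carrier := Subtype.property (p := (· ∈ E.carrier)) x

theorem toSeq_injective : Function.Injective E.toSeq := Subtype.val_injective

instance : Norm E.Elem := ⟨fun x => E.nrm (E.toSeq x)⟩

theorem norm_def (x : E.Elem) : ‖x‖ = E.nrm (E.toSeq x) := rfl

theorem normCore : NormedSpace.Core ℂ E.Elem where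
  norm_nonneg x := E.nrm_nonneg _ (E.toSeq_mem x)
  norm_smul c x := by
    rw [norm_def, norm_def, map_smul]
    exact E.nrm_smul c _ (E.toSeq_mem x)
  norm_triangle x y := by
    rw [norm_def, norm_def, norm_def, map_add]
    exact E.nrm_add_le _ (E.toSeq_mem x) _ (E.toSeq_mem y)
  norm_eq_zero_iff x := by
    rw [norm_def]
    constructor
    · intro h
      apply E.toSeq_injective
      rw [map_zero]
      exact E.eq_zero_of_nrm _ (E.toSeq_mem x) h
    · rintro rfl
      rw [map_zero]
      simpa using E.nrm_smul 0 0 E.carrier.zero_mem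

instance : NormedAddCommGroup E.Elem := NormedAddCommGroup.ofCore E.normCore

instance : NormedSpace ℂ E.Elem := NormedSpace.ofCore E.normCore

/-- A sequence in `E`, regarded as an element of the type `E.Elem`. -/
def ofMem (x : ℕ → ℂ) (hx : x ∈ E.carrier) : E.Elem := Subtype.mk x hx

theorem toSeq_ofMem (x : ℕ → ℂ) (hx : x ∈ E.carrier) : E.toSeq (E.ofMem x hx) = x := rfl

instance : CompleteSpace E.Elem := by
  refine Metric.complete_of_cauchySeq_tendsto fun u hu => ?_
  rw [Metric.cauchySeq_iff] at hu
  obtain ⟨x, hx, h⟩ := E.complete (fun m => E.toSeq (u m)) (fun m => E.toSeq_mem _) (by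
    intro ε hε
    obtain ⟨N, hN⟩ := hu ε hε
    refine ⟨N, fun p hp q hq => ?_⟩
    have := hN p hp q hq
    rwa [dist_eq_norm, norm_def, map_sub] at this)
  refine ⟨E.ofMem x hx, ?_⟩
  rw [tendsto_iff_norm_sub_tendsto_zero]
  refine h.congr fun m => ?_
  rw [norm_def, map_sub, toSeq_ofMem]

/-- The decreasing rearrangement
`x⋆ (k) = inf { sup_{j ∉ J} |x j| : J ⊆ ℕ, card J < k }`; the index starts here at `0`
instead of `1`, whence `card J ≤ k`. -/
def rearr (x : ℕ → ℂ) (k : ℕ) : ℝ :=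
  ⨅ J : {J : Finset ℕ // J.card ≤ k}, ⨆ j : {j : ℕ // j ∉ J.1}, ‖x j.1‖

/-- `E` is symmetric: `‖x‖ = ‖x⋆‖` for every `x ∈ E` (in particular `x⋆ ∈ E`). -/
def IsSymmetric : Prop :=
  ∀ x ∈ E.carrier, (fun k => (rearr x k : ℂ)) ∈ E.carrier ∧
    E.nrm x = E.nrm (fun k => (rearr x k : ℂ))

/-! The Köthe dual -/

/-- The sequences `z` with `∑ |z(k) x(k)| < ∞` for all `x ∈ E`. -/
def kotheCarrier : Submodule ℂ (ℕ → ℂ) where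
  carrier := {z | ∀ x ∈ E.carrier, Summable fun k => ‖z k * x k‖}
  zero_mem' := by
    intro x _
    simp
  add_mem' := by
    intro a b ha hb x hx
    refine Summable.of_nonneg_of_le (fun _ => norm_nonneg _) (fun k => ?_) ((ha x hx).add (hb x hx))
    rw [Pi.add_apply, add_mul]
    exact norm_add_le _ _
  smul_mem' := by
    intro c a ha x hx
    have := (ha x hx).mul_left ‖c‖
    refine this.congr fun k => ?_
    rw [Pi.smul_apply, smul_eq_mul, mul_assoc, norm_mul c]

/-- `‖z‖ = sup { ∑ |z(k) x(k)| : x ∈ E, ‖x‖ ≤ 1 }`. -/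
def kotheNrm (z : ℕ → ℂ) : ℝ :=
  sSup {r : ℝ | ∃ x ∈ E.carrier, E.nrm x ≤ 1 ∧ r = ∑' k, ‖z k * x k‖}

theorem mem_kotheCarrier {z : ℕ → ℂ} :
    z ∈ E.kotheCarrier ↔ ∀ x ∈ E.carrier, Summable fun k => ‖z k * x k‖ := Iff.rfl

/-- A consequence of the uniform boundedness principle. -/
theorem exists_bound {X : Type*} [NormedAddCommGroup X] [NormedSpace ℂ X] [CompleteSpace X]
    (ev : ℕ → X →L[ℂ] ℂ) (z : ℕ → ℂ) (h : ∀ x, Summable fun k => ‖z k * ev k x‖) :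
    ∃ C, 0 ≤ C ∧ ∀ x, ∑' k, ‖z k * ev k x‖ ≤ C * ‖x‖ := by
  let g : Finset ℕ × (ℕ → {c : ℂ // ‖c‖ ≤ 1}) → X →L[ℂ] ℂ := fun i =>
    ∑ k ∈ i.1, ((i.2 k : ℂ) * z k) • ev k
  have hg : ∀ i x, g i x = ∑ k ∈ i.1, (i.2 k : ℂ) * (z k * ev k x) := by
    intro i x
    simp [g, mul_assoc]
  obtain ⟨C, hC⟩ := banach_steinhaus (g := g) (by
    intro x
    refine ⟨∑' k, ‖z k * ev k x‖, fun i => ?_⟩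
    rw [hg]
    refine (norm_sum_le _ _).trans ?_
    refine le_trans (Finset.sum_le_sum fun k _ => ?_) ((h x).sum_le_tsum i.1 fun _ _ => norm_nonneg _)
    rw [norm_mul]
    exact mul_le_of_le_one_left (norm_nonneg _) (i.2 k).2)
  have hC0 : 0 ≤ C := (norm_nonneg _).trans (hC (∅, fun _ => ⟨0, by simp⟩))
  refine ⟨C, hC0, fun x => ?_⟩
  refine (h x).tsum_le_of_sum_le fun s => ?_
  have hph : ∀ w : ℂ, ∃ c : {c : ℂ // ‖c‖ ≤ 1}, (c : ℂ) * w = (‖w‖ : ℂ) := by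
    intro w
    by_cases hw : w = 0
    · exact ⟨⟨0, by simp⟩, by simp [hw]⟩
    · have hw' : (‖w‖ : ℂ) ≠ 0 := by simpa using hw
      refine ⟨⟨(‖w‖ : ℂ) / w, ?_⟩, div_mul_cancel₀ _ hw⟩
      rw [norm_div, Complex.norm_real, norm_norm, div_self (norm_ne_zero_iff.mpr hw)]
  choose c hc using hph
  have key := hg (s, fun k => c (z k * ev k x)) x
  simp only [hc] at key
  have h1 : ‖g (s, fun k => c (z k * ev k x)) x‖ = ∑ k ∈ s, ‖z k * ev k x‖ := by
    rw [key, ← Complex.ofReal_sum, Complex.norm_real, Real.norm_of_nonneg]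
    exact Finset.sum_nonneg fun _ _ => norm_nonneg _
  rw [← h1]
  exact ((g _).le_opNorm x).trans (mul_le_mul_of_nonneg_right (hC _) (norm_nonneg _))

theorem single_mem (k : ℕ) : (Pi.single k 1 : ℕ → ℂ) ∈ E.carrier := by
  refine E.l1_le _ (summable_of_ne_finset_zero (s := {k}) fun j hj => ?_)
  rw [Finset.mem_singleton] at hj
  simp [Pi.single_eq_of_ne hj]

theorem nrm_single_pos (k : ℕ) : 0 < E.nrm (Pi.single k 1) := by
  refine lt_of_le_of_ne (E.nrm_nonneg _ (E.single_mem k)) fun h => ?_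
  have := congrFun (E.eq_zero_of_nrm _ (E.single_mem k) h.symm) k
  simp at this

theorem norm_apply_mul_le {x : ℕ → ℂ} (hx : x ∈ E.carrier) (k : ℕ) :
    ‖x k‖ * E.nrm (Pi.single k 1) ≤ E.nrm x := by
  rw [← E.nrm_smul _ _ (E.single_mem k)]
  refine (E.solid _ x hx fun j => ?_).2
  by_cases hj : j = k
  · subst hj; simp
  · simp [Pi.single_eq_of_ne hj]

/-- The coordinate functionals of `E`. -/
def coord (k : ℕ) : E.Elem →L[ℂ] ℂ :=
  LinearMap.mkContinuous ((LinearMap.proj k).comp E.toSeq) (E.nrm (Pi.single k 1))⁻¹ (by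
    intro x
    have h := E.norm_apply_mul_le (E.toSeq_mem x) k
    rw [norm_def, inv_mul_eq_div, le_div_iff₀ (E.nrm_single_pos k)]
    exact h)

theorem coord_apply (k : ℕ) (x : E.Elem) : E.coord k x = E.toSeq x k := rfl

theorem kothe_bound {z : ℕ → ℂ} (hz : z ∈ E.kotheCarrier) :
    BddAbove {r : ℝ | ∃ x ∈ E.carrier, E.nrm x ≤ 1 ∧ r = ∑' k, ‖z k * x k‖} := by
  obtain ⟨C, hC0, hC⟩ := exists_bound E.coord z fun x => hz _ (E.toSeq_mem x)
  refine ⟨C, ?_⟩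
  rintro r ⟨x, hx, hx1, rfl⟩
  refine (hC (E.ofMem x hx)).trans (mul_le_of_le_one_right hC0 ?_)
  exact hx1

theorem nrm_zero : E.nrm 0 = 0 := by
  simpa using E.nrm_smul 0 0 E.carrier.zero_mem

theorem kotheNrm_nonneg (z : ℕ → ℂ) : 0 ≤ E.kotheNrm z := by
  refine Real.sSup_nonneg ?_
  rintro r ⟨x, _, _, rfl⟩
  exact tsum_nonneg fun _ => norm_nonneg _

theorem tsum_le_kotheNrm {z x : ℕ → ℂ} (hz : z ∈ E.kotheCarrier) (hx : x ∈ E.carrier) :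
    ∑' k, ‖z k * x k‖ ≤ E.kotheNrm z * E.nrm x := by
  rcases (E.nrm_nonneg x hx).eq_or_lt with h | h
  · rw [E.eq_zero_of_nrm x hx h.symm]
    simp [E.nrm_zero]
  · have hm : ((E.nrm x : ℂ)⁻¹ • x) ∈ E.carrier := E.carrier.smul_mem _ hx
    have h1 : E.nrm ((E.nrm x : ℂ)⁻¹ • x) = 1 := by
      rw [E.nrm_smul _ _ hx, norm_inv, Complex.norm_real, Real.norm_of_nonneg h.le,
        inv_mul_cancel₀ h.ne']
    have h2 := le_csSup (E.kothe_bound hz) ⟨_, hm, h1.le, rfl⟩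
    have h3 : ∑' k, ‖z k * ((E.nrm x : ℂ)⁻¹ • x) k‖ = (∑' k, ‖z k * x k‖) * (E.nrm x)⁻¹ := by
      rw [← tsum_mul_right]
      refine tsum_congr fun k => ?_
      rw [Pi.smul_apply, smul_eq_mul, mul_left_comm, norm_mul, norm_inv, Complex.norm_real,
        Real.norm_of_nonneg h.le, mul_comm]
    rw [h3, ← div_eq_mul_inv, div_le_iff₀ h] at h2
    exact h2

theorem kotheNrm_le {z : ℕ → ℂ} {C : ℝ}
    (h : ∀ x ∈ E.carrier, E.nrm x ≤ 1 → ∑' k, ‖z k * x k‖ ≤ C) : E.kotheNrm z ≤ C := by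
  refine csSup_le ⟨_, 0, E.carrier.zero_mem, by rw [E.nrm_zero]; exact zero_le_one, rfl⟩ ?_
  rintro r ⟨x, hx, hx1, rfl⟩
  exact h x hx hx1

theorem norm_apply_le_kotheNrm {z : ℕ → ℂ} (hz : z ∈ E.kotheCarrier) (k : ℕ) :
    ‖z k‖ ≤ E.kotheNrm z * E.nrm (Pi.single k 1) := by
  refine le_trans ?_ (E.tsum_le_kotheNrm hz (E.single_mem k))
  have := (hz _ (E.single_mem k)).le_tsum k (fun _ _ => norm_nonneg _)
  simpa using this

theorem kothe_linf {z : ℕ → ℂ} (hz : z ∈ E.kotheCarrier) :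
    BddAbove (Set.range fun k => ‖z k‖) := by
  obtain ⟨C, hC0, hC⟩ := exists_bound (X := lp (fun _ : ℕ => ℂ) 1)
    (fun k => lp.evalCLM ℂ (fun _ : ℕ => ℂ) 1 k) z (fun x => hz _ (E.l1_le _ (by
      have := (lp.memℓp x).summable (by simp)
      simpa [lp.evalCLM] using this)))
  refine ⟨C, ?_⟩
  rintro _ ⟨k, rfl⟩
  have h1 := hC (lp.single 1 k (1 : ℂ))
  rw [lp.norm_single (by simp), norm_one, mul_one] at h1
  refine le_trans ?_ h1
  have h2 : Summable fun j => ‖z j * lp.evalCLM ℂ (fun _ : ℕ => ℂ) 1 j (lp.single 1 k (1 : ℂ))‖ := by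
    refine summable_of_ne_finset_zero (s := {k}) fun j hj => ?_
    rw [Finset.mem_singleton] at hj
    simp [lp.evalCLM, Pi.single_eq_of_ne hj]
  have h3 := h2.le_tsum k (fun _ _ => norm_nonneg _)
  simpa [lp.evalCLM] using h3

theorem kothe_add_le {z w : ℕ → ℂ} (hz : z ∈ E.kotheCarrier) (hw : w ∈ E.kotheCarrier) :
    E.kotheNrm (z + w) ≤ E.kotheNrm z + E.kotheNrm w := by
  refine E.kotheNrm_le fun x hx hx1 => ?_
  have h1 := (E.tsum_le_kotheNrm hz hx).trans (mul_le_of_le_one_right (E.kotheNrm_nonneg z) hx1)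
  have h2 := (E.tsum_le_kotheNrm hw hx).trans (mul_le_of_le_one_right (E.kotheNrm_nonneg w) hx1)
  refine le_trans ?_ (add_le_add h1 h2)
  rw [← (hz x hx).tsum_add (hw x hx)]
  refine Summable.tsum_le_tsum (fun k => ?_) (E.kotheCarrier.add_mem hz hw x hx)
    ((hz x hx).add (hw x hx))
  rw [Pi.add_apply, add_mul]
  exact norm_add_le _ _

theorem kothe_smul_le (c : ℂ) {z : ℕ → ℂ} (hz : z ∈ E.kotheCarrier) :
    E.kotheNrm (c • z) ≤ ‖c‖ * E.kotheNrm z := by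
  refine E.kotheNrm_le fun x hx hx1 => ?_
  have h1 := (E.tsum_le_kotheNrm hz hx).trans (mul_le_of_le_one_right (E.kotheNrm_nonneg z) hx1)
  have h2 : ∑' k, ‖(c • z) k * x k‖ = ‖c‖ * ∑' k, ‖z k * x k‖ := by
    rw [← tsum_mul_left]
    refine tsum_congr fun k => ?_
    rw [Pi.smul_apply, smul_eq_mul, mul_assoc, norm_mul c]
  rw [h2]
  exact mul_le_mul_of_nonneg_left h1 (norm_nonneg _)

theorem kothe_complete (u : ℕ → ℕ → ℂ) (hu : ∀ m, u m ∈ E.kotheCarrier)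
    (hc : ∀ ε > 0, ∃ N, ∀ p ≥ N, ∀ q ≥ N, E.kotheNrm (u p - u q) < ε) :
    ∃ z ∈ E.kotheCarrier, Tendsto (fun m => E.kotheNrm (u m - z)) atTop (𝓝 0) := by
  have hd : ∀ p q, u p - u q ∈ E.kotheCarrier := fun p q => E.kotheCarrier.sub_mem (hu p) (hu q)
  have hlim : ∀ k, ∃ l, Tendsto (fun m => u m k) atTop (𝓝 l) := by
    intro k
    refine cauchySeq_tendsto_of_complete (Metric.cauchySeq_iff.mpr fun ε hε => ?_)
    obtain ⟨N, hN⟩ := hc (ε / E.nrm (Pi.single k 1)) (div_pos hε (E.nrm_single_pos k))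
    refine ⟨N, fun p hp q hq => ?_⟩
    have h1 := E.norm_apply_le_kotheNrm (hd p q) k
    have h2 := (lt_div_iff₀ (E.nrm_single_pos k)).mp (hN p hp q hq)
    rw [dist_eq_norm]
    exact h1.trans_lt h2
  choose z hz using hlim
  have hfin : ∀ ε > 0, ∃ N, ∀ p ≥ N, ∀ x ∈ E.carrier, ∀ s : Finset ℕ,
      ∑ k ∈ s, ‖(u p - z) k * x k‖ ≤ ε * E.nrm x := by
    intro ε hε
    obtain ⟨N, hN⟩ := hc ε hε
    refine ⟨N, fun p hp x hx s => ?_⟩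
    have ht : Tendsto (fun q => ∑ k ∈ s, ‖(u p - u q) k * x k‖) atTop
        (𝓝 (∑ k ∈ s, ‖(u p - z) k * x k‖)) := by
      refine tendsto_finsetSum _ fun k _ => ?_
      exact ((tendsto_const_nhds.sub (hz k)).mul_const _).norm
    refine le_of_tendsto ht (eventually_atTop.mpr ⟨N, fun q hq => ?_⟩)
    refine ((hd p q x hx).sum_le_tsum s fun _ _ => norm_nonneg _).trans ?_
    exact (E.tsum_le_kotheNrm (hd p q) hx).trans
      (mul_le_mul_of_nonneg_right (hN p hp q hq).le (E.nrm_nonneg x hx))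
  have hmem : ∃ p, u p - z ∈ E.kotheCarrier := by
    obtain ⟨N, hN⟩ := hfin 1 one_pos
    exact ⟨N, fun x hx => summable_of_sum_le (fun _ => norm_nonneg _) (hN N le_rfl x hx)⟩
  obtain ⟨p, hp⟩ := hmem
  refine ⟨z, by simpa using E.kotheCarrier.sub_mem (hu p) hp, ?_⟩
  rw [Metric.tendsto_atTop]
  intro ε hε
  obtain ⟨N, hN⟩ := hfin (ε / 2) (half_pos hε)
  refine ⟨N, fun m hm => ?_⟩
  rw [Real.dist_eq, sub_zero, abs_of_nonneg (E.kotheNrm_nonneg _)]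
  refine lt_of_le_of_lt (E.kotheNrm_le fun x hx hx1 => ?_) (half_lt_self hε)
  refine Real.tsum_le_of_sum_le (fun _ => norm_nonneg _) fun s => ?_
  exact (hN m hm x hx s).trans (mul_le_of_le_one_right (half_pos hε).le hx1)

/-- The Köthe dual `E^×`, which is again a Banach sequence space. -/
def kotheDual : BanachSeqSpace where
  carrier := E.kotheCarrier
  nrm := E.kotheNrm
  nrm_nonneg z _ := E.kotheNrm_nonneg z
  eq_zero_of_nrm z hz h := by
    funext k
    have := E.norm_apply_le_kotheNrm hz k
    rw [h, zero_mul] at this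
    simpa using this
  nrm_add_le z hz w hw := E.kothe_add_le hz hw
  nrm_smul c z hz := by
    refine le_antisymm (E.kothe_smul_le c hz) ?_
    by_cases h : c = 0
    · simp [h, E.kotheNrm_nonneg]
    · have h1 := E.kothe_smul_le c⁻¹ (E.kotheCarrier.smul_mem c hz)
      rw [smul_smul, inv_mul_cancel₀ h, one_smul, norm_inv, inv_mul_eq_div,
        le_div_iff₀ (norm_pos_iff.mpr h)] at h1
      rwa [mul_comm]
  complete := E.kothe_complete
  l1_le z hz := by
    intro x hx
    obtain ⟨C, hC⟩ := E.le_linf x hx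
    refine Summable.of_nonneg_of_le (fun _ => norm_nonneg _) (fun k => ?_) (hz.mul_right C)
    rw [norm_mul]
    exact mul_le_mul_of_nonneg_left (hC ⟨k, rfl⟩) (norm_nonneg _)
  le_linf z hz := E.kothe_linf hz
  solid z w hw h := by
    have hle : ∀ (x : ℕ → ℂ) k, ‖z k * x k‖ ≤ ‖w k * x k‖ := fun x k => by
      rw [norm_mul, norm_mul]
      exact mul_le_mul_of_nonneg_right (h k) (norm_nonneg _)
    have hz : z ∈ E.kotheCarrier := fun x hx =>
      Summable.of_nonneg_of_le (fun _ => norm_nonneg _) (hle x) (hw x hx)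
    refine ⟨hz, E.kotheNrm_le fun x hx hx1 => ?_⟩
    exact ((hz x hx).tsum_le_tsum (hle x) (hw x hx)).trans
      ((E.tsum_le_kotheNrm hw hx).trans (mul_le_of_le_one_right (E.kotheNrm_nonneg w) hx1))

end BanachSeqSpace

/-! Ideals of multilinear forms -/

/-- The form `(x₁, …, xₙ) ↦ γ₁(x₁) ⋯ γₙ(xₙ)`. -/
def elementaryForm {n : ℕ} {F : Fin n → Type} [∀ i, NormedAddCommGroup (F i)]
    [∀ i, NormedSpace ℂ (F i)] (γ : ∀ i, F i →L[ℂ] ℂ) : ContinuousMultilinearMap ℂ F ℂ :=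
  (ContinuousMultilinearMap.mkPiAlgebra ℂ (Fin n) ℂ).compContinuousLinearMap γ

theorem elementaryForm_apply {n : ℕ} {F : Fin n → Type} [∀ i, NormedAddCommGroup (F i)]
    [∀ i, NormedSpace ℂ (F i)] (γ : ∀ i, F i →L[ℂ] ℂ) (x : ∀ i, F i) :
    elementaryForm γ x = ∏ i, γ i (x i) := by
  simp [elementaryForm]

/-- An ideal of `n`-linear forms: for all complex Banach spaces `F₁, …, Fₙ` a set
`𝔄(F₁, …, Fₙ)` of continuous `n`-linear forms on `F₁ × ⋯ × Fₙ`, with the three ideal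
properties. -/
structure MultilinearIdeal (n : ℕ) where
  forms : ∀ (F : Fin n → Type) [∀ i, NormedAddCommGroup (F i)] [∀ i, NormedSpace ℂ (F i)]
    [∀ i, CompleteSpace (F i)], Set (ContinuousMultilinearMap ℂ F ℂ)
  elementary_mem : ∀ (F : Fin n → Type) [∀ i, NormedAddCommGroup (F i)]
    [∀ i, NormedSpace ℂ (F i)] [∀ i, CompleteSpace (F i)] (γ : ∀ i, F i →L[ℂ] ℂ),
    elementaryForm γ ∈ forms F
  add_mem : ∀ (F : Fin n → Type) [∀ i, NormedAddCommGroup (F i)]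
    [∀ i, NormedSpace ℂ (F i)] [∀ i, CompleteSpace (F i)], ∀ S ∈ forms F, ∀ T ∈ forms F,
    S + T ∈ forms F
  comp_mem : ∀ (F G : Fin n → Type) [∀ i, NormedAddCommGroup (F i)]
    [∀ i, NormedSpace ℂ (F i)] [∀ i, CompleteSpace (F i)] [∀ i, NormedAddCommGroup (G i)]
    [∀ i, NormedSpace ℂ (G i)] [∀ i, CompleteSpace (G i)], ∀ T ∈ forms F,
    ∀ S : ∀ i, G i →L[ℂ] F i, T.compContinuousLinearMap S ∈ forms G

/-- A normed ideal of `n`-linear forms: an ideal with a norm on each `𝔄(F₁, …, Fₙ)` that is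
multiplicative on elementary forms and has the ideal inequality. The values of `nrm` on forms
outside the ideal carry no information. -/
structure NormedMultilinearIdeal (n : ℕ) extends MultilinearIdeal n where
  nrm : ∀ (F : Fin n → Type) [∀ i, NormedAddCommGroup (F i)] [∀ i, NormedSpace ℂ (F i)]
    [∀ i, CompleteSpace (F i)], ContinuousMultilinearMap ℂ F ℂ → ℝ
  nrm_nonneg : ∀ (F : Fin n → Type) [∀ i, NormedAddCommGroup (F i)]
    [∀ i, NormedSpace ℂ (F i)] [∀ i, CompleteSpace (F i)], ∀ T ∈ forms F, 0 ≤ nrm F T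
  eq_zero_of_nrm : ∀ (F : Fin n → Type) [∀ i, NormedAddCommGroup (F i)]
    [∀ i, NormedSpace ℂ (F i)] [∀ i, CompleteSpace (F i)], ∀ T ∈ forms F, nrm F T = 0 → T = 0
  nrm_add_le : ∀ (F : Fin n → Type) [∀ i, NormedAddCommGroup (F i)]
    [∀ i, NormedSpace ℂ (F i)] [∀ i, CompleteSpace (F i)], ∀ S ∈ forms F, ∀ T ∈ forms F,
    nrm F (S + T) ≤ nrm F S + nrm F T
  nrm_smul : ∀ (F : Fin n → Type) [∀ i, NormedAddCommGroup (F i)]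
    [∀ i, NormedSpace ℂ (F i)] [∀ i, CompleteSpace (F i)] (c : ℂ), ∀ T ∈ forms F,
    nrm F (c • T) = ‖c‖ * nrm F T
  nrm_elementary : ∀ (F : Fin n → Type) [∀ i, NormedAddCommGroup (F i)]
    [∀ i, NormedSpace ℂ (F i)] [∀ i, CompleteSpace (F i)] (γ : ∀ i, F i →L[ℂ] ℂ),
    nrm F (elementaryForm γ) = ∏ i, ‖γ i‖
  nrm_comp_le : ∀ (F G : Fin n → Type) [∀ i, NormedAddCommGroup (F i)]
    [∀ i, NormedSpace ℂ (F i)] [∀ i, CompleteSpace (F i)] [∀ i, NormedAddCommGroup (G i)]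
    [∀ i, NormedSpace ℂ (G i)] [∀ i, CompleteSpace (G i)], ∀ T ∈ forms F,
    ∀ S : ∀ i, G i →L[ℂ] F i, nrm G (T.compContinuousLinearMap S) ≤ nrm F T * ∏ i, ‖S i‖

/-- A Banach ideal of `n`-linear forms: a normed ideal all of whose components are complete. -/
structure BanachMultilinearIdeal (n : ℕ) extends NormedMultilinearIdeal n where
  complete : ∀ (F : Fin n → Type) [∀ i, NormedAddCommGroup (F i)]
    [∀ i, NormedSpace ℂ (F i)] [∀ i, CompleteSpace (F i)]
    (u : ℕ → ContinuousMultilinearMap ℂ F ℂ), (∀ m, u m ∈ forms F) →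
    (∀ ε > 0, ∃ N, ∀ p ≥ N, ∀ q ≥ N, nrm F (u p - u q) < ε) →
    ∃ T ∈ forms F, Tendsto (fun m => nrm F (u m - T)) atTop (𝓝 0)

namespace NormedMultilinearIdeal

variable {n : ℕ} (𝔄 : NormedMultilinearIdeal n)

/-- `‖T|_{M₁ × ⋯ × Mₙ}‖_𝔄` for finite-dimensional subspaces `Mᵢ ⊆ Fᵢ`. -/
def restrictNrm {F : Fin n → Type} [∀ i, NormedAddCommGroup (F i)] [∀ i, NormedSpace ℂ (F i)]
    (T : ContinuousMultilinearMap ℂ F ℂ) (M : ∀ i, Submodule ℂ (F i))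
    (hM : ∀ i, FiniteDimensional ℂ (M i)) : ℝ :=
  haveI : ∀ i, CompleteSpace (M i) := fun i =>
    haveI := hM i
    FiniteDimensional.complete ℂ (M i)
  𝔄.nrm (fun i => M i) (T.compContinuousLinearMap fun i => (M i).subtypeL)

/-- The numbers `‖T|_{M₁ × ⋯ × Mₙ}‖_𝔄`, where `Mᵢ ⊆ Fᵢ` with `dim Mᵢ < ∞`. -/
def finNrms {F : Fin n → Type} [∀ i, NormedAddCommGroup (F i)] [∀ i, NormedSpace ℂ (F i)]
    (T : ContinuousMultilinearMap ℂ F ℂ) : Set ℝ :=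
  {r | ∃ (M : ∀ i, Submodule ℂ (F i)) (hM : ∀ i, FiniteDimensional ℂ (M i)),
    r = 𝔄.restrictNrm T M hM}

/-- `T` belongs to the maximal hull `𝔄^max`: the supremum of the norms in `𝔄` of its
restrictions to finite-dimensional subspaces is finite. -/
def maxForms (F : Fin n → Type) [∀ i, NormedAddCommGroup (F i)] [∀ i, NormedSpace ℂ (F i)] :
    Set (ContinuousMultilinearMap ℂ F ℂ) :=
  {T | BddAbove (𝔄.finNrms T)}

/-- The norm of the maximal hull `𝔄^max`. -/
def maxNrm (F : Fin n → Type) [∀ i, NormedAddCommGroup (F i)] [∀ i, NormedSpace ℂ (F i)]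
    (T : ContinuousMultilinearMap ℂ F ℂ) : ℝ :=
  sSup (𝔄.finNrms T)

/-- `𝔄` is maximal: `𝔄 = 𝔄^max`, with equality of norms. -/
def IsMaximal : Prop :=
  ∀ (F : Fin n → Type) [∀ i, NormedAddCommGroup (F i)] [∀ i, NormedSpace ℂ (F i)]
    [∀ i, CompleteSpace (F i)],
    𝔄.forms F = 𝔄.maxForms F ∧ ∀ T ∈ 𝔄.forms F, 𝔄.nrm F T = 𝔄.maxNrm F T

end NormedMultilinearIdeal

/-! Diagonal forms and the spaces `ℓₙ(𝔄, E)` -/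

/-- `T = T_α`, that is, `T(x₁, …, xₙ) = ∑ₖ α(k) x₁(k) ⋯ xₙ(k)` for all `x₁, …, xₙ ∈ E`. -/
def IsDiagonal {n : ℕ} (E : BanachSeqSpace) (α : ℕ → ℂ)
    (T : ContinuousMultilinearMap ℂ (fun _ : Fin n => E.Elem) ℂ) : Prop :=
  ∀ x : Fin n → E.Elem,
    Tendsto (fun K => ∑ k ∈ Finset.range K, α k * ∏ i, x i k) atTop (𝓝 (T x))

theorem IsDiagonal.unique {n : ℕ} {E : BanachSeqSpace} {α : ℕ → ℂ}
    {S T : ContinuousMultilinearMap ℂ (fun _ : Fin n => E.Elem) ℂ}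
    (hS : IsDiagonal E α S) (hT : IsDiagonal E α T) : S = T := by
  ext x
  exact tendsto_nhds_unique (hS x) (hT x)

open Classical in
/-- The diagonal form `T_α` on `E × ⋯ × E`, whenever it exists as a continuous `n`-linear form
(and `0` otherwise). -/
def diagonalForm (n : ℕ) (E : BanachSeqSpace) (α : ℕ → ℂ) :
    ContinuousMultilinearMap ℂ (fun _ : Fin n => E.Elem) ℂ :=
  if h : ∃ T, IsDiagonal E α T then h.choose else 0

theorem IsDiagonal.diagonalForm_eq {n : ℕ} {E : BanachSeqSpace} {α : ℕ → ℂ}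
    {T : ContinuousMultilinearMap ℂ (fun _ : Fin n => E.Elem) ℂ}
    (hT : IsDiagonal E α T) : diagonalForm n E α = T := by
  have h : ∃ T : ContinuousMultilinearMap ℂ (fun _ : Fin n => E.Elem) ℂ, IsDiagonal E α T :=
    ⟨T, hT⟩
  rw [diagonalForm, dif_pos h]
  exact h.choose_spec.unique hT

/-- `ℓₙ(𝔄, E) = {α ∈ ℓ_∞ : T_α ∈ 𝔄(E, …, E)}`. -/
def ellN {n : ℕ} (𝔄 : NormedMultilinearIdeal n) (E : BanachSeqSpace) : Set (ℕ → ℂ) :=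
  {α | BddAbove (Set.range fun k => ‖α k‖) ∧
    ∃ T ∈ 𝔄.forms (fun _ => E.Elem), IsDiagonal E α T}

/-- `‖α‖_{ℓₙ(𝔄, E)} = ‖T_α‖_{𝔄(E, …, E)}`. -/
def ellNNrm {n : ℕ} (𝔄 : NormedMultilinearIdeal n) (E : BanachSeqSpace) (α : ℕ → ℂ) : ℝ :=
  𝔄.nrm (fun _ => E.Elem) (diagonalForm n E α)

end

open Filter Topology

noncomputable section

/-! ### Truncation and inclusion between `E` and its Köthe bidual -/

namespace BanachSeqSpace

variable (E : BanachSeqSpace)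

/-! `E` and `E^××` are tied together by two kinds of contractions that do not change coordinates:
the inclusion `E → E^××`, and the truncations `P_N : E^×× → E` to the first `N` coordinates. The
latter are contractions because, by Hahn–Banach on finitely supported sequences, the norm of `E` is
at most that of `E^××` there (`nrm_truncSeq_le_kotheDual_kotheDual`).

Composing a diagonal form on `E^××` with the inclusion gives the diagonal form on `E`, so the ideal
property settles one direction and one norm inequality.

Conversely, let `T` be the diagonal form of `α` on `E`. Rotating phases in a single variable turns
continuity of `T` into absolute convergence of the diagonal series on `E^××`
(`IsDiagonal.sum_norm_le`), so the form has a continuous extension `S` to `E^××`. The composition `T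
∘ (P_N, …, P_N)` is the `N`-th partial sum of that series, hence `S` is a pointwise limit of
compositions of `T` with contractions. On finite-dimensional subspaces the ideal norm is controlled
by finitely many values of the form, so the bound by the norm of `T` survives the limit there;
maximality then carries it to all of `E^××` (`IsMaximal.mem_and_nrm_le_of_tendsto`). -/

/-- The truncation of a sequence to its first `N` coordinates. -/
def truncSeq (N : ℕ) : (ℕ → ℂ) →ₗ[ℂ] (ℕ → ℂ) where
  toFun x k := if k < N then x k else 0
  map_add' x y := by ext k; by_cases h : k < N <;> simp [h]
  map_smul' c x := by ext k; by_cases h : k < N <;> simp [h]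

theorem truncSeq_apply (N : ℕ) (x : ℕ → ℂ) (k : ℕ) :
    truncSeq N x k = if k < N then x k else 0 := rfl

theorem norm_truncSeq_le (N : ℕ) (x : ℕ → ℂ) (k : ℕ) : ‖truncSeq N x k‖ ≤ ‖x k‖ := by
  rw [truncSeq_apply]
  split_ifs <;> simp

theorem truncSeq_mem (N : ℕ) (x : ℕ → ℂ) : truncSeq N x ∈ E.carrier := by
  refine E.l1_le _ (summable_of_ne_finset_zero (s := Finset.range N) fun k hk => ?_)
  rw [Finset.mem_range] at hk
  simp [truncSeq_apply, hk]

theorem truncSeq_eq_sum (N : ℕ) (x : ℕ → ℂ) :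
    truncSeq N x = ∑ k ∈ Finset.range N, x k • (Pi.single k 1 : ℕ → ℂ) := by
  ext j
  simp [truncSeq_apply, Finset.sum_apply, Pi.single_apply]

theorem exists_phase (w : ℂ) : ∃ c : ℂ, ‖c‖ ≤ 1 ∧ c * w = (‖w‖ : ℂ) := by
  by_cases hw : w = 0
  · exact ⟨0, by simp, by simp [hw]⟩
  · refine ⟨(‖w‖ : ℂ) / w, ?_, div_mul_cancel₀ _ hw⟩
    rw [norm_div, Complex.norm_real, norm_norm, div_self (norm_ne_zero_iff.mpr hw)]

/-- On finitely supported sequences the norm of `E` is dominated by the norm of `E^××`. -/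
theorem nrm_truncSeq_le_kotheDual_kotheDual (N : ℕ) (x : ℕ → ℂ) :
    E.nrm (truncSeq N x) ≤ E.kotheDual.kotheDual.nrm (truncSeq N x) := by
  let e : ℕ → E.Elem := fun k => E.ofMem _ (E.single_mem k)
  let tr : (ℕ → ℂ) → E.Elem := fun y => E.ofMem _ (E.truncSeq_mem N y)
  have htr : ∀ y, tr y = ∑ k ∈ Finset.range N, y k • e k := by
    intro y
    apply E.toSeq_injective
    rw [toSeq_ofMem, map_sum, truncSeq_eq_sum]
    exact Finset.sum_congr rfl fun k _ => by rw [map_smul, toSeq_ofMem]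
  -- Hahn–Banach: a functional in the unit ball of the dual of `E` that norms the truncation of `x`.
  obtain ⟨g, hg1, hgx⟩ := exists_dual_vector'' ℂ (tr x)
  have hgtr : ∀ y, g (tr y) = ∑ k ∈ Finset.range N, y k * g (e k) := by
    intro y
    simp [htr]
  -- The first `N` coordinates of `g`. This sequence will lie in the unit ball of `E^×`, and pairing
  -- it with the truncation of `x` bounds the norm `g (tr x)` from above.
  set z : ℕ → ℂ := truncSeq N fun k => g (e k) with hz
  have hzy : ∀ y : ℕ → ℂ, ∑' k, ‖z k * y k‖ = ∑ k ∈ Finset.range N, ‖g (e k) * y k‖ := by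
    intro y
    rw [tsum_eq_sum (s := Finset.range N)]
    · refine Finset.sum_congr rfl fun k hk => ?_
      rw [hz, truncSeq_apply, if_pos (Finset.mem_range.mp hk)]
    · intro k hk
      rw [hz, truncSeq_apply, if_neg (by simpa using hk)]
      simp
  have hzm : z ∈ E.kotheDual.carrier := E.kotheDual.truncSeq_mem N _
  have hz1 : E.kotheDual.nrm z ≤ 1 := by
    refine E.kotheNrm_le fun y hy hy1 => ?_
    choose c hc1 hc using exists_phase
    -- Rotating the coordinates of `y` makes `g` add up absolute values; by solidity the rotated and
    -- truncated sequence stays in the unit ball of `E`.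
    have h1 : g (tr fun k => c (g (e k) * y k) * y k) =
        ((∑ k ∈ Finset.range N, ‖g (e k) * y k‖ : ℝ) : ℂ) := by
      rw [hgtr, Complex.ofReal_sum]
      refine Finset.sum_congr rfl fun k _ => ?_
      rw [← hc]
      ring
    have h2 : ‖tr fun k => c (g (e k) * y k) * y k‖ ≤ 1 := by
      refine le_trans (E.solid _ y hy fun k => ?_).2 hy1
      refine (norm_truncSeq_le N (fun k => c (g (e k) * y k) * y k) k).trans ?_
      rw [norm_mul]
      exact mul_le_of_le_one_left (norm_nonneg _) (hc1 _)
    have h3 := g.le_of_opNorm_le hg1 (tr fun k => c (g (e k) * y k) * y k)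
    rw [h1, Complex.norm_real, Real.norm_of_nonneg (Finset.sum_nonneg fun _ _ => norm_nonneg _)]
      at h3
    rw [hzy]
    linarith
  have h4 : E.nrm (truncSeq N x) = ‖∑ k ∈ Finset.range N, x k * g (e k)‖ := by
    rw [← hgtr, hgx]
    exact (RCLike.norm_coe_norm (𝕜 := ℂ) (z := tr x)).symm
  have hxm : truncSeq N x ∈ E.kotheDual.kotheCarrier :=
    E.kotheDual.kotheDual.truncSeq_mem N x
  have h5 := E.kotheDual.tsum_le_kotheNrm hxm hzm
  have h6 : ∑' k, ‖truncSeq N x k * z k‖ = ∑ k ∈ Finset.range N, ‖x k * g (e k)‖ := by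
    simp_rw [mul_comm _ (z _)]
    rw [hzy]
    refine Finset.sum_congr rfl fun k hk => ?_
    rw [truncSeq_apply, if_pos (Finset.mem_range.mp hk), mul_comm]
  rw [h4]
  refine (norm_sum_le _ _).trans ?_
  rw [← h6]
  exact h5.trans (mul_le_of_le_one_right (E.kotheDual.kotheNrm_nonneg _) hz1)

theorem nrm_truncSeq_le {x : ℕ → ℂ} (N : ℕ) (hx : x ∈ E.kotheDual.kotheDual.carrier) :
    E.nrm (truncSeq N x) ≤ E.kotheDual.kotheDual.nrm x :=
  (E.nrm_truncSeq_le_kotheDual_kotheDual N x).trans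
    (E.kotheDual.kotheDual.solid _ x hx (norm_truncSeq_le N x)).2

/-- The truncation operator from `E^××` to `E`. -/
def trunc (N : ℕ) : E.kotheDual.kotheDual.Elem →L[ℂ] E.Elem :=
  LinearMap.mkContinuous
    { toFun := fun x => E.ofMem _ (E.truncSeq_mem N (E.kotheDual.kotheDual.toSeq x))
      map_add' := fun x y => E.toSeq_injective (by
        simp only [map_add, toSeq_ofMem])
      map_smul' := fun c x => E.toSeq_injective (by
        simp only [map_smul, RingHom.id_apply, toSeq_ofMem]) } 1
    (fun x => by
      rw [one_mul]
      exact E.nrm_truncSeq_le N (E.kotheDual.kotheDual.toSeq_mem x))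

theorem toSeq_trunc (N : ℕ) (x : E.kotheDual.kotheDual.Elem) :
    E.toSeq (E.trunc N x) = truncSeq N (E.kotheDual.kotheDual.toSeq x) := rfl

theorem norm_trunc_le (N : ℕ) : ‖E.trunc N‖ ≤ 1 :=
  LinearMap.mkContinuous_norm_le _ zero_le_one _

theorem mem_kotheDual_kotheDual {x : ℕ → ℂ} (hx : x ∈ E.carrier) :
    x ∈ E.kotheDual.kotheDual.carrier := fun z hz =>
  (E.mem_kotheCarrier.mp hz x hx).congr fun k => by rw [mul_comm]

theorem kotheDual_kotheDual_nrm_le {x : ℕ → ℂ} (hx : x ∈ E.carrier) :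
    E.kotheDual.kotheDual.nrm x ≤ E.nrm x := by
  refine E.kotheDual.kotheNrm_le fun z hz hz1 => ?_
  simp_rw [mul_comm (x _)]
  exact (E.tsum_le_kotheNrm hz hx).trans (mul_le_of_le_one_left (E.nrm_nonneg x hx) hz1)

/-- The inclusion of `E` into `E^××`. -/
def toKotheBidual : E.Elem →L[ℂ] E.kotheDual.kotheDual.Elem :=
  LinearMap.mkContinuous
    { toFun := fun x =>
        E.kotheDual.kotheDual.ofMem (E.toSeq x) (E.mem_kotheDual_kotheDual (E.toSeq_mem x))
      map_add' := fun x y => E.kotheDual.kotheDual.toSeq_injective (by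
        simp only [map_add, toSeq_ofMem])
      map_smul' := fun c x => E.kotheDual.kotheDual.toSeq_injective (by
        simp only [map_smul, RingHom.id_apply, toSeq_ofMem]) } 1
    (fun x => by
      rw [one_mul]
      exact E.kotheDual_kotheDual_nrm_le (E.toSeq_mem x))

theorem norm_toKotheBidual_le : ‖E.toKotheBidual‖ ≤ 1 :=
  LinearMap.mkContinuous_norm_le _ zero_le_one _

/-- Multiplication of the elements of `E` by a sequence bounded by `1`. -/
theorem exists_mul (c : ℕ → ℂ) (hc : ∀ k, ‖c k‖ ≤ 1) (x : E.Elem) :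
    ∃ y : E.Elem, (∀ k, y k = c k * x k) ∧ ‖y‖ ≤ ‖x‖ := by
  have h := E.solid (fun k => c k * x k) _ (E.toSeq_mem x) fun k => by
    rw [norm_mul]
    exact mul_le_of_le_one_left (norm_nonneg _) (hc k)
  exact ⟨E.ofMem _ h.1, fun k => rfl, h.2⟩

end BanachSeqSpace

/-! ### Ideal norms on finite-dimensional spaces, and maximality -/

namespace NormedMultilinearIdeal

variable {n : ℕ} (𝔄 : NormedMultilinearIdeal n)

section

variable {F : Fin n → Type} [∀ i, NormedAddCommGroup (F i)] [∀ i, NormedSpace ℂ (F i)]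
  [∀ i, CompleteSpace (F i)]

/-- Closure under scalars is not an axiom of an ideal; the scalar is absorbed into the first
variable, which is why `1 ≤ n` enters. -/
theorem smul_mem (hn : 1 ≤ n) (c : ℂ) {T : ContinuousMultilinearMap ℂ F ℂ}
    (hT : T ∈ 𝔄.forms F) : c • T ∈ 𝔄.forms F := by
  have h := 𝔄.comp_mem F F T hT fun i =>
    (if i = ⟨0, hn⟩ then c else 1) • ContinuousLinearMap.id ℂ (F i)
  convert h using 1
  ext x
  have h1 := T.map_smul_univ (fun i => if i = ⟨0, hn⟩ then c else 1) x
  rw [Finset.prod_ite_eq' Finset.univ _ fun _ => c, if_pos (Finset.mem_univ _)] at h1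
  exact h1.symm

theorem zero_mem (hn : 1 ≤ n) : (0 : ContinuousMultilinearMap ℂ F ℂ) ∈ 𝔄.forms F := by
  have h := 𝔄.smul_mem hn 0 (𝔄.elementary_mem F 0)
  rwa [show (0 : ℂ) • elementaryForm (F := F) 0 = 0 by ext x; exact zero_mul _] at h

theorem nrm_zero (hn : 1 ≤ n) : 𝔄.nrm F 0 = 0 := by
  have h := 𝔄.nrm_smul F 0 0 (𝔄.zero_mem hn)
  rwa [show (0 : ℂ) • (0 : ContinuousMultilinearMap ℂ F ℂ) = 0 by ext x; exact zero_mul _,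
    norm_zero, zero_mul] at h

theorem sum_mem_and_nrm_sum_le (hn : 1 ≤ n) {ι : Type*} (s : Finset ι)
    (f : ι → ContinuousMultilinearMap ℂ F ℂ) (hf : ∀ i ∈ s, f i ∈ 𝔄.forms F) :
    ∑ i ∈ s, f i ∈ 𝔄.forms F ∧ 𝔄.nrm F (∑ i ∈ s, f i) ≤ ∑ i ∈ s, 𝔄.nrm F (f i) := by
  classical
  induction s using Finset.induction_on with
  | empty => simp [𝔄.zero_mem hn, 𝔄.nrm_zero hn]
  | insert a s ha ih =>
    obtain ⟨h1, h2⟩ := ih fun i hi => hf i (Finset.mem_insert_of_mem hi)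
    have h3 := hf a (Finset.mem_insert_self a s)
    rw [Finset.sum_insert ha, Finset.sum_insert ha]
    exact ⟨𝔄.add_mem F _ h3 _ h1,
      (𝔄.nrm_add_le F _ h3 _ h1).trans (add_le_add_right h2 _)⟩

/-- On finite-dimensional spaces every form belongs to the ideal, and its norm is controlled by
its values on a basis. -/
theorem exists_nrm_le_of_finiteDimensional (hn : 1 ≤ n) [∀ i, FiniteDimensional ℂ (F i)] :
    ∃ (ι : Type) (_ : Fintype ι) (v : ι → ∀ i, F i) (C : ι → ℝ),
      ∀ S : ContinuousMultilinearMap ℂ F ℂ,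
        S ∈ 𝔄.forms F ∧ 𝔄.nrm F S ≤ ∑ r, ‖S (v r)‖ * C r := by
  let b := fun i => Module.finBasis ℂ (F i)
  let γ : (∀ i, Fin (Module.finrank ℂ (F i))) → ∀ i, F i →L[ℂ] ℂ := fun r i =>
    LinearMap.toContinuousLinearMap ((b i).coord (r i))
  refine ⟨∀ i, Fin (Module.finrank ℂ (F i)), inferInstance, fun r i => b i (r i),
    fun r => ∏ i, ‖γ r i‖, fun S => ?_⟩
  -- Expanding every argument in a basis writes `S` as a finite combination of elementary forms in
  -- the coordinate functionals. The constants `C r` are the norms of these elementary forms.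
  have hS : S = ∑ r : ∀ i, Fin (Module.finrank ℂ (F i)),
      S (fun i => b i (r i)) • elementaryForm (γ r) := by
    ext x
    rw [sum_apply]
    have h1 : x = fun i => ∑ j, (b i).coord j (x i) • b i j := by
      ext i
      exact ((b i).sum_repr (x i)).symm
    conv_lhs => rw [h1]
    rw [S.map_sum]
    refine Finset.sum_congr rfl fun r _ => ?_
    rw [S.map_smul_univ, smul_apply, elementaryForm_apply, smul_eq_mul,
      smul_eq_mul, mul_comm]
    rfl
  have h := 𝔄.sum_mem_and_nrm_sum_le hn Finset.univ
    (fun r => S (fun i => b i (r i)) • elementaryForm (γ r))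
    fun r _ => 𝔄.smul_mem hn _ (𝔄.elementary_mem F _)
  rw [← hS] at h
  refine ⟨h.1, h.2.trans (Finset.sum_le_sum fun r _ => ?_)⟩
  rw [𝔄.nrm_smul F _ _ (𝔄.elementary_mem F _), 𝔄.nrm_elementary]

/-- The ideal norm of `S - u m` is bounded through finitely many values of `S - u m`, all tending to
`0`; the triangle inequality then passes the bound `C` to the limit. -/
theorem nrm_le_of_tendsto (hn : 1 ≤ n) [∀ i, FiniteDimensional ℂ (F i)]
    {S : ContinuousMultilinearMap ℂ F ℂ} {u : ℕ → ContinuousMultilinearMap ℂ F ℂ} {C : ℝ}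
    (hu : ∀ x, Tendsto (fun m => u m x) atTop (𝓝 (S x))) (hC : ∀ m, 𝔄.nrm F (u m) ≤ C) :
    𝔄.nrm F S ≤ C := by
  obtain ⟨ι, _, v, c, h⟩ := 𝔄.exists_nrm_le_of_finiteDimensional (F := F) hn
  have hlim : Tendsto (fun m => C + ∑ r, ‖(S - u m) (v r)‖ * c r) atTop (𝓝 C) := by
    have h1 : ∀ r, Tendsto (fun m => ‖(S - u m) (v r)‖ * c r) atTop (𝓝 0) := fun r => by
      have := ((tendsto_const_nhds (x := S (v r))).sub (hu (v r))).norm.mul_const (c r)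
      simpa using this
    simpa using (tendsto_const_nhds (x := C)).add (tendsto_finsetSum Finset.univ fun r _ => h1 r)
  refine ge_of_tendsto' hlim fun m => ?_
  have h2 := 𝔄.nrm_add_le F (u m) (h _).1 (S - u m) (h _).1
  rw [add_sub_cancel] at h2
  exact h2.trans (add_le_add (hC m) (h _).2)

theorem nrm_comp_le_of_norm_le_one {G : Fin n → Type} [∀ i, NormedAddCommGroup (G i)]
    [∀ i, NormedSpace ℂ (G i)] [∀ i, CompleteSpace (G i)] {T : ContinuousMultilinearMap ℂ F ℂ}
    (hT : T ∈ 𝔄.forms F) (S : ∀ i, G i →L[ℂ] F i) (hS : ∀ i, ‖S i‖ ≤ 1) :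
    𝔄.nrm G (T.compContinuousLinearMap S) ≤ 𝔄.nrm F T :=
  (𝔄.nrm_comp_le F G T hT S).trans (mul_le_of_le_one_right (𝔄.nrm_nonneg F T hT)
    (Finset.prod_le_one (fun _ _ => norm_nonneg _) fun i _ => hS i))

/-- A maximal ideal is closed under pointwise limits of the compositions of a form in the ideal
with contractions. -/
theorem IsMaximal.mem_and_nrm_le_of_tendsto {𝔄 : NormedMultilinearIdeal n} (h𝔄 : 𝔄.IsMaximal)
    (hn : 1 ≤ n) {G : Fin n → Type} [∀ i, NormedAddCommGroup (G i)]
    [∀ i, NormedSpace ℂ (G i)] [∀ i, CompleteSpace (G i)] {T : ContinuousMultilinearMap ℂ F ℂ}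
    (hT : T ∈ 𝔄.forms F) (P : ℕ → ∀ i, G i →L[ℂ] F i) (hP : ∀ m i, ‖P m i‖ ≤ 1)
    {S : ContinuousMultilinearMap ℂ G ℂ}
    (hS : ∀ x, Tendsto (fun m => T fun i => P m i (x i)) atTop (𝓝 (S x))) :
    S ∈ 𝔄.forms G ∧ 𝔄.nrm G S ≤ 𝔄.nrm F T := by
  have hle : ∀ r ∈ 𝔄.finNrms S, r ≤ 𝔄.nrm F T := by
    rintro r ⟨M, hM, rfl⟩
    have : ∀ i, CompleteSpace (M i) := fun i =>
      have := hM i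
      FiniteDimensional.complete ℂ (M i)
    -- The restriction of `S` to the `M i` is the limit of `T` composed with the contractions `P m
    -- i` restricted to `M i`, so the bound does not depend on the `M i`.
    refine 𝔄.nrm_le_of_tendsto hn
      (u := fun m => T.compContinuousLinearMap fun i => (P m i).comp (M i).subtypeL)
      (fun x => hS fun i => x i) fun m => ?_
    refine 𝔄.nrm_comp_le_of_norm_le_one hT _ fun i => ?_
    refine (ContinuousLinearMap.opNorm_comp_le _ _).trans ?_
    exact mul_le_one₀ (hP m i) (norm_nonneg _) (Submodule.norm_subtypeL_le _)
  have hmem : S ∈ 𝔄.forms G := by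
    rw [(h𝔄 G).1]
    exact ⟨_, hle⟩
  refine ⟨hmem, ?_⟩
  rw [(h𝔄 G).2 S hmem]
  exact Real.sSup_le hle (𝔄.nrm_nonneg F T hT)

end

end NormedMultilinearIdeal

/-! ### Diagonal forms on `E` and on its Köthe bidual -/

namespace IsDiagonal

variable {n : ℕ} {E : BanachSeqSpace} {α : ℕ → ℂ}

/-- At truncated arguments the diagonal series is constant from `N` on: for `k ≥ N` the product
contains a vanishing factor, since `1 ≤ n` excludes the empty product. -/
theorem apply_trunc {T : ContinuousMultilinearMap ℂ (fun _ : Fin n => E.Elem) ℂ}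
    (hn : 1 ≤ n) (hT : IsDiagonal E α T) (N : ℕ) (x : Fin n → E.kotheDual.kotheDual.Elem) :
    T (fun i => E.trunc N (x i)) = ∑ k ∈ Finset.range N, α k * ∏ i, x i k := by
  refine tendsto_nhds_unique (hT _) (tendsto_const_nhds.congr' ?_)
  filter_upwards [eventually_ge_atTop N] with K hK
  rw [← Finset.sum_subset (Finset.range_mono hK)]
  · refine Finset.sum_congr rfl fun k hk => ?_
    simp only [E.toSeq_trunc, BanachSeqSpace.truncSeq_apply, if_pos (Finset.mem_range.mp hk)]
  · intro k _ hk
    rw [Finset.prod_eq_zero (Finset.mem_univ ⟨0, hn⟩), mul_zero]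
    rw [E.toSeq_trunc, BanachSeqSpace.truncSeq_apply, if_neg (by simpa using hk)]

/-- A continuous diagonal form on `E` is bounded, with absolute values inside the sum, with
respect to the norm of `E^××`. -/
theorem sum_norm_le {T : ContinuousMultilinearMap ℂ (fun _ : Fin n => E.Elem) ℂ}
    (hn : 1 ≤ n) (hT : IsDiagonal E α T) (N : ℕ) (x : Fin n → E.kotheDual.kotheDual.Elem) :
    ∑ k ∈ Finset.range N, ‖α k * ∏ i, x i k‖ ≤ ‖T‖ * ∏ i, ‖x i‖ := by
  choose c hc1 hc using BanachSeqSpace.exists_phase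
  -- The phase goes into the first variable only, so that it occurs exactly once in each product.
  have hy : ∀ i : Fin n, ∃ y : E.kotheDual.kotheDual.Elem,
      (∀ k, y k = (if i = ⟨0, hn⟩ then c (α k * ∏ i, x i k) else 1) * x i k) ∧ ‖y‖ ≤ ‖x i‖ :=
    fun i => E.kotheDual.kotheDual.exists_mul _ (fun k => by split_ifs <;> simp [hc1]) (x i)
  choose y hy1 hy2 using hy
  have h1 : T (fun i => E.trunc N (y i)) =
      ((∑ k ∈ Finset.range N, ‖α k * ∏ i, x i k‖ : ℝ) : ℂ) := by
    rw [hT.apply_trunc hn, Complex.ofReal_sum]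
    refine Finset.sum_congr rfl fun k _ => ?_
    simp only [hy1, Finset.prod_mul_distrib, Finset.prod_ite_eq', Finset.mem_univ, if_true]
    rw [← hc]
    ring
  have h2 := T.le_opNorm fun i => E.trunc N (y i)
  rw [h1, Complex.norm_real, Real.norm_of_nonneg (Finset.sum_nonneg fun _ _ => norm_nonneg _)]
    at h2
  refine h2.trans (mul_le_mul_of_nonneg_left ?_ (norm_nonneg _))
  refine Finset.prod_le_prod (fun _ _ => norm_nonneg _) fun i _ => ?_
  have h3 := (E.trunc N).le_of_opNorm_le (E.norm_trunc_le N) (y i)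
  rw [one_mul] at h3
  exact h3.trans (hy2 i)

theorem summable {T : ContinuousMultilinearMap ℂ (fun _ : Fin n => E.Elem) ℂ}
    (hn : 1 ≤ n) (hT : IsDiagonal E α T) (x : Fin n → E.kotheDual.kotheDual.Elem) :
    Summable fun k => ‖α k * ∏ i, x i k‖ :=
  summable_of_sum_range_le (fun _ => norm_nonneg _) fun N => hT.sum_norm_le hn N x

/-- A continuous diagonal form on `E` extends to a continuous diagonal form on `E^××`. -/
theorem exists_kotheDual_kotheDual
    {T : ContinuousMultilinearMap ℂ (fun _ : Fin n => E.Elem) ℂ}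
    (hn : 1 ≤ n) (hT : IsDiagonal E α T) :
    ∃ S : ContinuousMultilinearMap ℂ (fun _ : Fin n => E.kotheDual.kotheDual.Elem) ℂ,
      IsDiagonal E.kotheDual.kotheDual α S := by
  have hs := fun x => (hT.summable hn x).of_norm
  -- Isolates the factor of the updated variable, in which each term is linear. The decidability
  -- instance is arbitrary because the multilinearity conditions quantify over it.
  have hprod : ∀ [DecidableEq (Fin n)] (x : Fin n → E.kotheDual.kotheDual.Elem) (i : Fin n)
      (y : E.kotheDual.kotheDual.Elem) (k : ℕ),
      ∏ j, Function.update x i y j k = y k * ∏ j ∈ Finset.univ.erase i, x j k := by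
    intro _ x i y k
    rw [← Finset.mul_prod_erase _ _ (Finset.mem_univ i), Function.update_self]
    congr 1
    refine Finset.prod_congr rfl fun j hj => ?_
    rw [Function.update_of_ne (Finset.ne_of_mem_erase hj)]
  let S₀ : MultilinearMap ℂ (fun _ : Fin n => E.kotheDual.kotheDual.Elem) ℂ :=
    { toFun := fun x => ∑' k, α k * ∏ i, x i k
      map_update_add' := fun x i y z => by
        rw [← (hs _).tsum_add (hs _)]
        refine tsum_congr fun k => ?_
        rw [hprod, hprod, hprod, map_add, Pi.add_apply]
        ring
      map_update_smul' := fun x i c y => by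
        rw [smul_eq_mul, ← tsum_mul_left]
        refine tsum_congr fun k => ?_
        rw [hprod, hprod, map_smul, Pi.smul_apply, smul_eq_mul]
        ring }
  refine ⟨S₀.mkContinuous ‖T‖ fun x => ?_, fun x => (hs x).hasSum.tendsto_sum_nat⟩
  refine (norm_tsum_le_tsum_norm (hT.summable hn x)).trans ?_
  exact Real.tsum_le_of_sum_range_le (fun _ => norm_nonneg _) fun N => hT.sum_norm_le hn N x

/-- The inclusion leaves coordinates unchanged, so the partial sums on both spaces are literally the
same. -/
theorem comp_toKotheBidual
    {S : ContinuousMultilinearMap ℂ (fun _ : Fin n => E.kotheDual.kotheDual.Elem) ℂ}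
    (hS : IsDiagonal E.kotheDual.kotheDual α S) :
    IsDiagonal E α (S.compContinuousLinearMap fun _ => E.toKotheBidual) :=
  fun x => hS fun i => E.toKotheBidual (x i)

end IsDiagonal

/-! ### Equality of the two spaces of diagonal coefficients -/

theorem proposition5p5 (n : ℕ) (hn : 1 ≤ n) (𝔄 : BanachMultilinearIdeal n)
    (h𝔄 : 𝔄.toNormedMultilinearIdeal.IsMaximal) (E : BanachSeqSpace) (hE : E.IsSymmetric) :
    ellN 𝔄.toNormedMultilinearIdeal E =
        ellN 𝔄.toNormedMultilinearIdeal E.kotheDual.kotheDual ∧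
      ∀ α ∈ ellN 𝔄.toNormedMultilinearIdeal E,
        ellNNrm 𝔄.toNormedMultilinearIdeal E α =
          ellNNrm 𝔄.toNormedMultilinearIdeal E.kotheDual.kotheDual α := by
  have key : ∀ α T, T ∈ 𝔄.forms (fun _ => E.Elem) → IsDiagonal E α T →
      ∃ S ∈ 𝔄.forms (fun _ => E.kotheDual.kotheDual.Elem),
        IsDiagonal E.kotheDual.kotheDual α S ∧ 𝔄.nrm _ S ≤ 𝔄.nrm _ T := by
    intro α T hT hd
    obtain ⟨S, hS⟩ := hd.exists_kotheDual_kotheDual hn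
    -- By `apply_trunc`, the value of `T` at the truncated arguments is the `N`-th partial sum of
    -- the series defining `S`.
    have h := h𝔄.mem_and_nrm_le_of_tendsto hn hT (fun N _ => E.trunc N)
      (fun N _ => E.norm_trunc_le N) (S := S) fun x => by
        simpa only [hd.apply_trunc hn] using hS x
    exact ⟨S, h.1, hS, h.2⟩
  refine ⟨Set.ext fun α => ⟨?_, ?_⟩, ?_⟩
  · rintro ⟨hα, T, hT, hd⟩
    obtain ⟨S, hS, hSd, _⟩ := key α T hT hd
    exact ⟨hα, S, hS, hSd⟩
  · rintro ⟨hα, S, hS, hd⟩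
    exact ⟨hα, _, 𝔄.comp_mem _ _ S hS _, hd.comp_toKotheBidual⟩
  · rintro α ⟨_, T, hT, hd⟩
    obtain ⟨S, hS, hSd, hle⟩ := key α T hT hd
    rw [ellNNrm, ellNNrm, hd.diagonalForm_eq, hSd.diagonalForm_eq]
    refine le_antisymm ?_ hle
    -- Uniqueness identifies `T` with `S` composed with the inclusion, which is a contraction.
    rw [hd.unique hSd.comp_toKotheBidual]
    exact 𝔄.nrm_comp_le_of_norm_le_one hS _ fun _ => E.norm_toKotheBidual_le

end
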